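/- **Setting.** Let $k\ge 1$, $K\ge 0$ be integers, $\mathcal S=\{0,\dots,K\}^k$, $\delta\ge 0$, $\lambda>0$. On a probability space let - $0=T_0\le T_1\le T_2\le\cdots$ be the arrival times of a Poisson process of rate $\lambda$ (the interarrival times $T_n-T_{n-1}$, $n\ge1$, are i.i.d. exponential with mean $1/\lambda$), and let $N_t$ be the number of $n\ge 1$ with $T_n\le t$; - $(X_n)_{n\ge 0}$, $X_n=(X_{n1},\dots,X_{nk})$, be a stationary ergodic (irreducible) Markov chain on $\mathcal S$ with transition matrix $P=(p(x,x'))_{x,x'\in\mathcal S}$; - $(L_{nj})_{n\ge 0,\,1\le j\le k}$ be independent real random variables, the law of $L_{nj}$ depending only on $j$, and let $L_j$ denote a generic random variable with that law; the three families $(T_n)$, $(X_n)$, $(L_{nj})$ being independent. Put $$\tilde Z_i(t)=e^{\delta t}\sum_{n=1}^{N_t}X_{ni}\,e^{-\delta(L_{ni}+T_n)}\mathbf 1_{[t<L_{ni}+T_n]},\qquad M_i(t)=\Big[\mathbb E\big(\tilde Z_i(t)\mathbf 1_{[X_{N_t}=y]}\,\big|\,X_0=x\big)\Big]_{(x,y)\in\mathcal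 S^2},$$ and let $\Delta_i=\mathrm{diag}(x_i,\ x=(x_1,\dots,x_k)\in\mathcal S)$ and $I$ be the identity matrix. **Theorem.** For every $i\in\{1,\dots,k\}$ and $t\ge 0$ the matrix $M_i(t)$ is well defined (each event $[X_0=x]$ has positive probability and the random variables $\tilde Z_i(t)\mathbf 1_{[X_{N_t}=y]}$ are integrable given it), the entries of the integrand below are integrable on $[0,t]$, and $$M_i(t)=\lambda e^{\lambda t(P-I)}\int_0^t\mathbb E\big(e^{-\delta(L_i-v)}\mathbf 1_{[L_i>v]}\big)\,e^{-\lambda v(P-I)}\,P\Delta_i\,e^{\lambda v(P-I)}\,dv .$$ -/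

import Mathlib

open MeasureTheory ProbabilityTheory

noncomputable section

namespace IBNR

/-- The state space `{0, …, K}^k`. -/
abbrev State (k K : ℕ) : Type := Fin k → Fin (K + 1)

variable {Ω : Type*} [MeasurableSpace Ω]

/-- `T 0, T 1, T 2, …` are the arrival times of a renewal process under `μ`: `T 0 = 0`, the
sequence is nondecreasing, and the interarrival times `T (n + 1) - T n` are independent with
common law `ν`. -/
structure IsRenewalSequence (μ : Measure Ω) (T : ℕ → Ω → ℝ) (ν : Measure ℝ) : Prop where
  measurable : ∀ n, Measurable (T n)
  zero : ∀ᵐ ω ∂μ, T 0 ω = 0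
  mono : ∀ᵐ ω ∂μ, Monotone fun n => T n ω
  indep : iIndepFun (fun n ω => T (n + 1) ω - T n ω) μ
  law : ∀ n, HasLaw (fun ω => T (n + 1) ω - T n ω) ν μ

/-- `X 0, X 1, X 2, …` is a stationary ergodic (irreducible) Markov chain on the finite set `S`
with transition matrix `P` under `μ`. -/
structure IsStationaryErgodicChain {S : Type*} [Fintype S] [DecidableEq S] [MeasurableSpace S]
    (μ : Measure Ω) (X : ℕ → Ω → S) (P : Matrix S S ℝ) : Prop where
  measurable : ∀ n, Measurable (X n)
  stochastic : P ∈ Matrix.rowStochastic ℝ S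
  markov : ∀ (n : ℕ) (x : ℕ → S) (y : S),
    μ.real {ω | (∀ m ≤ n, X m ω = x m) ∧ X (n + 1) ω = y} =
      μ.real {ω | ∀ m ≤ n, X m ω = x m} * P (x n) y
  stationary : ∀ n, IdentDistrib (X n) (X 0) μ μ
  irreducible : P.IsIrreducible

/-- The delays `L n j` (of the `n`-th arrival, in coordinate `j`) are independent random variables,
the law of `L n j` being `ρ j` for every `n`. -/
structure IsDelayFamily {k : ℕ} (μ : Measure Ω) (L : ℕ → Fin k → Ω → ℝ)
    (ρ : Fin k → Measure ℝ) : Prop where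
  measurable : ∀ n j, Measurable (L n j)
  indep : iIndepFun (fun p : ℕ × Fin k => L p.1 p.2) μ
  law : ∀ n j, HasLaw (L n j) (ρ j) μ

/-- The number `N_t` of arrivals in `[0, t]`, i.e. of indices `n ≥ 1` with `T n ≤ t`
(almost surely finite for a renewal process whose interarrival times are positive). -/
def count (T : ℕ → Ω → ℝ) (t : ℝ) (ω : Ω) : ℕ :=
  {n : ℕ | 1 ≤ n ∧ T n ω ≤ t}.ncard

open Classical in
/-- The discounted process
`Z_j(t) = ∑_{n=1}^{N_t} X_{n j} e^{-δ (L_{n j} + T_n)} 1_{t < L_{n j} + T_n}`. -/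
def Z {k K : ℕ} (T : ℕ → Ω → ℝ) (X : ℕ → Ω → State k K) (L : ℕ → Fin k → Ω → ℝ) (δ : ℝ)
    (j : Fin k) (t : ℝ) (ω : Ω) : ℝ :=
  ∑ n ∈ Finset.Icc 1 (count T t ω),
    ((X n ω j : ℕ) : ℝ) * Real.exp (-δ * (L n j ω + T n ω)) *
      (if t < L n j ω + T n ω then 1 else 0)

/-- The process `Z̃_j(t) = e^{δ t} Z_j(t)`. -/
def Ztilde {k K : ℕ} (T : ℕ → Ω → ℝ) (X : ℕ → Ω → State k K) (L : ℕ → Fin k → Ω → ℝ) (δ : ℝ)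
    (j : Fin k) (t : ℝ) (ω : Ω) : ℝ :=
  Real.exp (δ * t) * Z T X L δ j t ω

/-- The random variable `Z̃_i(t) 1_{X_{N_t} = y}`. -/
def momentVar {k K : ℕ} (T : ℕ → Ω → ℝ) (X : ℕ → Ω → State k K) (L : ℕ → Fin k → Ω → ℝ)
    (δ : ℝ) (i : Fin k) (t : ℝ) (y : State k K) (ω : Ω) : ℝ :=
  Ztilde T X L δ i t ω * (if X (count T t ω) ω = y then 1 else 0)

/-- The first joint moment `M_i(t)`, the matrix with entries `E(Z̃_i(t) 1_{X_{N_t} = y} | X_0 = x)`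
(elementary conditional expectation given the event `X_0 = x`). -/
def M {k K : ℕ} (μ : Measure Ω) (T : ℕ → Ω → ℝ) (X : ℕ → Ω → State k K)
    (L : ℕ → Fin k → Ω → ℝ) (δ : ℝ) (i : Fin k) (t : ℝ) :
    Matrix (State k K) (State k K) ℝ :=
  Matrix.of fun x y => ∫ ω, momentVar T X L δ i t y ω ∂(cond μ {ω | X 0 ω = x})

/-- The diagonal matrix `Δ_i = diag(x_i, x ∈ {0, …, K}^k)`. -/
def Delta (k K : ℕ) (i : Fin k) : Matrix (State k K) (State k K) ℝ :=
  Matrix.diagonal fun x => ((x i : ℕ) : ℝ)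

open Classical in
/-- `E(e^{-δ (L - v)} 1_{L > v})` for a random variable `L` with law `ρ`. -/
def discountedTail (ρ : Measure ℝ) (δ v : ℝ) : ℝ :=
  ∫ l, Real.exp (-δ * (l - v)) * (if v < l then 1 else 0) ∂ρ

/-- The matrix `E(e^{-δ (L - v)} 1_{L > v}) e^{-λ v (P - I)} P Δ_i e^{λ v (P - I)}`, where
`L` has law `ρ`. -/
def integrand {k K : ℕ} (P : Matrix (State k K) (State k K) ℝ) (ρ : Measure ℝ) (lam δ : ℝ)
    (i : Fin k) (v : ℝ) : Matrix (State k K) (State k K) ℝ :=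
  discountedTail ρ δ v •
    (NormedSpace.exp (-(lam * v) • (P - 1)) * (P * Delta k K i) *
      NormedSpace.exp ((lam * v) • (P - 1)))

/-- The entrywise integral `∫_a^b A(v) dv` of a matrix-valued function. -/
def matrixIntegral {S : Type*} (A : ℝ → Matrix S S ℝ) (a b : ℝ) : Matrix S S ℝ :=
  Matrix.of fun x y => ∫ v in a..b, A v x y

end IBNR

end

open scoped ENNReal

namespace IBNR

variable {Ω : Type*} [MeasurableSpace Ω]

/-! The moment is a sum over arrivals. The `n`-th arrival (`n ≥ 1`) contributes when exactly `j`
further arrivals occur by time `t`, and then the final state is `X (n + j)`, so the variable is a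
double series over `(n, j)` of nonnegative terms (`ofReal_momentVar`).

In each term the chain is independent of times and delays. The chain factor gives `P ^ n * Δ_i * P ^
j` (`lintegral_mark`). For the other factor, the arrival time has Erlang density `λ w_{n-1}(s)`, the
`j` later arrivals have Poisson probability `w_j(t - s)`, and the delay averages to the discounted
tail at age `t - s` (`lintegral_arrival`, `lintegral_delay_arrival`).

Summing against Poisson weights turns powers of `P` into exponentials, since `∑ w_n(s) P ^ n = exp(λ
s (P - 1))`. The result is `exp(λ s (P - 1)) P Δ_i exp(λ (t - s) (P - 1))`; the substitution `v = t
- s` and the splitting of `exp(λ (t - v) (P - 1))` give the formula. Since everything is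
nonnegative, Tonelli justifies each interchange, and integrability follows at the end from
finiteness of the result. -/

lemma lintegral_prodMk_of_indepFun {α β : Type*} [MeasurableSpace α] [MeasurableSpace β]
    {μ : Measure Ω} [IsFiniteMeasure μ] {U : Ω → α} {V : Ω → β} (hU : Measurable U)
    (hV : Measurable V) (h : IndepFun U V μ) {F : α → β → ℝ≥0∞}
    (hF : Measurable (Function.uncurry F)) :
    ∫⁻ ω, F (U ω) (V ω) ∂μ = ∫⁻ ω, ∫⁻ ω', F (U ω) (V ω') ∂μ ∂μ := by
  have h1 : ∫⁻ ω, F (U ω) (V ω) ∂μ = ∫⁻ p, Function.uncurry F p ∂(μ.map fun ω => (U ω, V ω)) := by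
    rw [lintegral_map hF (hU.prodMk hV)]; rfl
  rw [h1, (indepFun_iff_map_prod_eq_prod_map_map hU.aemeasurable hV.aemeasurable).1 h,
    lintegral_prod _ hF.aemeasurable, lintegral_map hF.lintegral_prod_right' hU]
  refine lintegral_congr fun ω => ?_
  rw [lintegral_map (by fun_prop) hV]
  rfl

/-! ### Poisson weights and the exponential law -/

/-- The probability that a Poisson process of rate `lam` has `n` points in an interval of
length `s` (zero for negative `s`). -/
noncomputable def poissonWeight (lam : ℝ) (n : ℕ) (s : ℝ) : ℝ :=
  if 0 ≤ s then Real.exp (-(lam * s)) * (lam * s) ^ n / n.factorial else 0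

lemma poissonWeight_of_nonneg (lam : ℝ) (n : ℕ) {s : ℝ} (hs : 0 ≤ s) :
    poissonWeight lam n s = Real.exp (-(lam * s)) * (lam * s) ^ n / n.factorial := if_pos hs

lemma poissonWeight_of_neg (lam : ℝ) (n : ℕ) {s : ℝ} (hs : s < 0) :
    poissonWeight lam n s = 0 := if_neg hs.not_ge

lemma poissonWeight_nonneg {lam : ℝ} (hlam : 0 < lam) (n : ℕ) (s : ℝ) :
    0 ≤ poissonWeight lam n s := by
  unfold poissonWeight
  split_ifs
  · positivity
  · exact le_rfl

@[fun_prop]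
lemma measurable_poissonWeight (lam : ℝ) (n : ℕ) : Measurable (poissonWeight lam n) :=
  Measurable.ite measurableSet_Ici (by fun_prop) measurable_const

/-- Conditioning on the last arrival: it falls at `s` with density `lam * poissonWeight lam n s`,
and nothing follows on `(s, u]`. Analytically the exponentials combine and `∫_0^u s ^ n ds` remains;
the weights vanish at negative arguments, which cuts the line down to `[0, u]`. -/
lemma lintegral_poissonWeight_mul {lam : ℝ} (hlam : 0 < lam) (n : ℕ) (u : ℝ) :
    ∫⁻ s, ENNReal.ofReal (poissonWeight lam 0 (u - s)) *
        ENNReal.ofReal (lam * poissonWeight lam n s) =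
      ENNReal.ofReal (poissonWeight lam (n + 1) u) := by
  rcases lt_or_ge u 0 with hu | hu
  · rw [poissonWeight_of_neg _ _ hu, ENNReal.ofReal_zero, lintegral_eq_zero_iff (by fun_prop)]
    refine Filter.Eventually.of_forall fun s => ?_
    rcases lt_or_ge s 0 with hs | hs
    · simp [poissonWeight_of_neg _ _ hs]
    · simp [poissonWeight_of_neg lam 0 (show u - s < 0 by linarith)]
  have h1 : (fun s => ENNReal.ofReal (poissonWeight lam 0 (u - s)) *
      ENNReal.ofReal (lam * poissonWeight lam n s)) = (Set.Icc 0 u).indicator (fun s =>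
        ENNReal.ofReal (Real.exp (-(lam * u)) * lam ^ (n + 1) / n.factorial * s ^ n)) := by
    ext s
    by_cases hs : s ∈ Set.Icc 0 u
    · rw [Set.indicator_of_mem hs, ← ENNReal.ofReal_mul (poissonWeight_nonneg hlam _ _),
        poissonWeight_of_nonneg _ _ hs.1, poissonWeight_of_nonneg _ _ (sub_nonneg.2 hs.2)]
      congr 1
      have : Real.exp (-(lam * u)) = Real.exp (-(lam * (u - s))) * Real.exp (-(lam * s)) := by
        rw [← Real.exp_add]; ring_nf
      rw [this]
      simp only [pow_zero, Nat.factorial_zero, Nat.cast_one, mul_pow]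
      ring
    · rw [Set.indicator_of_notMem hs]
      rcases lt_or_ge s 0 with h | h
      · simp [poissonWeight_of_neg _ _ h]
      · have : u < s := by by_contra! h'; exact hs ⟨h, h'⟩
        simp [poissonWeight_of_neg lam 0 (show u - s < 0 by linarith)]
  rw [h1, lintegral_indicator measurableSet_Icc, ← ofReal_integral_eq_lintegral_ofReal]
  · rw [integral_Icc_eq_integral_Ioc, ← intervalIntegral.integral_of_le hu,
      intervalIntegral.integral_const_mul, integral_pow, poissonWeight_of_nonneg _ _ hu]
    congr 1
    rw [Nat.factorial_succ]
    push_cast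
    field_simp
    ring
  · exact (Continuous.continuousOn (by fun_prop)).integrableOn_Icc
  · filter_upwards [ae_restrict_mem measurableSet_Icc] with s hs
    have := hs.1
    simp only [Pi.zero_apply]
    positivity

lemma lintegral_expMeasure {lam : ℝ} {f : ℝ → ℝ≥0∞} (hf : Measurable f) :
    ∫⁻ w, f w ∂(expMeasure lam) = ∫⁻ w, f w * ENNReal.ofReal (lam * poissonWeight lam 0 w) := by
  have h : ∀ w, gammaPDF 1 lam w = ENNReal.ofReal (lam * poissonWeight lam 0 w) := by
    intro w
    have := exponentialPDF_eq lam w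
    rw [exponentialPDF, exponentialPDFReal] at this
    rw [gammaPDF, this]
    congr 1
    simp [poissonWeight]
  rw [expMeasure, gammaMeasure, lintegral_withDensity_eq_lintegral_mul _ (by
    exact (measurable_gammaPDFReal 1 lam).ennreal_ofReal) hf]
  refine lintegral_congr fun w => ?_
  simp [h, mul_comm]

lemma lintegral_expMeasure_shift {lam : ℝ} {f : ℝ → ℝ≥0∞} (hf : Measurable f) (s : ℝ) :
    ∫⁻ w, f (s + w) ∂(expMeasure lam) =
      ∫⁻ u, f u * ENNReal.ofReal (lam * poissonWeight lam 0 (u - s)) := by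
  rw [lintegral_expMeasure (by fun_prop)]
  rw [← lintegral_add_left_eq_self
    (fun u => f u * ENNReal.ofReal (lam * poissonWeight lam 0 (u - s))) s]
  simp

lemma expMeasure_tail {lam : ℝ} (hlam : 0 < lam) (r s : ℝ) :
    ∫⁻ w, (if s ≤ r ∧ r < s + w then 1 else 0) ∂(expMeasure lam) =
      ENNReal.ofReal (poissonWeight lam 0 (r - s)) := by
  have : IsProbabilityMeasure (expMeasure lam) := isProbabilityMeasure_expMeasure hlam
  by_cases h : s ≤ r
  · have h1 : (fun w => if s ≤ r ∧ r < s + w then (1 : ℝ≥0∞) else 0) =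
        (Set.Ioi (r - s)).indicator 1 := by
      ext w
      simp only [h, true_and, Set.indicator_apply, Set.mem_Ioi, sub_lt_iff_lt_add', Pi.one_apply]
    have h2 := cdf_expMeasure_eq hlam (r - s)
    rw [cdf_eq_real, if_pos (sub_nonneg.2 h)] at h2
    rw [h1, lintegral_indicator_one measurableSet_Ioi, ← Set.compl_Iic,
      ← ofReal_measureReal, probReal_compl_eq_one_sub measurableSet_Iic, h2,
      poissonWeight_of_nonneg _ _ (sub_nonneg.2 h)]
    simp
  · simp [h, poissonWeight_of_neg lam 0 (show r - s < 0 by linarith)]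

/-! ### Sums of i.i.d. exponential variables -/

section Sums

variable {μ : Measure Ω} [IsProbabilityMeasure μ] {W : ℕ → Ω → ℝ} {lam : ℝ}

/-- The Erlang density, by induction: adding one independent exponential variable convolves the
density, and `lintegral_poissonWeight_mul` evaluates the convolution. -/
lemma lintegral_sum_range_succ_exp (hlam : 0 < lam) (hm : ∀ n, Measurable (W n))
    (hi : iIndepFun W μ) (hl : ∀ n, HasLaw (W n) (expMeasure lam) μ) (n : ℕ) {f : ℝ → ℝ≥0∞}
    (hf : Measurable f) :
    ∫⁻ ω, f (∑ i ∈ Finset.range (n + 1), W i ω) ∂μ =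
      ∫⁻ s, f s * ENNReal.ofReal (lam * poissonWeight lam n s) := by
  induction n generalizing f with
  | zero =>
    simp only [zero_add, Finset.range_one, Finset.sum_singleton]
    rw [(hl 0).lintegral_comp hf.aemeasurable, lintegral_expMeasure hf]
  | succ n ih =>
    have hind : IndepFun (fun ω => ∑ i ∈ Finset.range (n + 1), W i ω) (W (n + 1)) μ := by
      have := hi.indepFun_finsetSum_of_notMem hm (s := Finset.range (n + 1)) (i := n + 1) (by simp)
      convert this using 1
      ext ω
      simp
    have hg : Measurable fun s => ∫⁻ w, f (s + w) ∂(expMeasure lam) := by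
      have : IsProbabilityMeasure (expMeasure lam) := isProbabilityMeasure_expMeasure hlam
      exact Measurable.lintegral_prod_right' (f := fun p : ℝ × ℝ => f (p.1 + p.2)) (by fun_prop)
    simp_rw [Finset.sum_range_succ _ (n + 1)]
    rw [lintegral_prodMk_of_indepFun (by fun_prop) (hm _) hind (F := fun a b => f (a + b))
      (by fun_prop)]
    have : ∀ ω, ∫⁻ ω', f (∑ i ∈ Finset.range (n + 1), W i ω + W (n + 1) ω') ∂μ =
        ∫⁻ w, f (∑ i ∈ Finset.range (n + 1), W i ω + w) ∂(expMeasure lam) := fun ω =>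
      (hl (n + 1)).lintegral_comp
        (f := fun w => f (∑ i ∈ Finset.range (n + 1), W i ω + w)) (by fun_prop)
    simp_rw [this]
    rw [ih hg]
    simp_rw [lintegral_expMeasure_shift hf]
    simp_rw [← lintegral_mul_const' _ _ ENNReal.ofReal_ne_top]
    rw [lintegral_lintegral_swap (by fun_prop)]
    refine lintegral_congr fun u => ?_
    simp_rw [mul_assoc]
    rw [lintegral_const_mul _ (by fun_prop), ENNReal.ofReal_mul hlam.le,
      ← lintegral_poissonWeight_mul hlam]
    congr 2
    rw [← lintegral_const_mul _ (by fun_prop)]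
    refine lintegral_congr fun s => ?_
    rw [ENNReal.ofReal_mul hlam.le, mul_assoc]

/-- The event says that exactly `j` arrivals occur by `r`. Integrating out the last gap leaves its
tail at `r` minus the partial sum. The case `j = 0` stands apart because an empty sum has no
density. -/
lemma lintegral_sum_range_le_lt (hlam : 0 < lam) (hm : ∀ n, Measurable (W n))
    (hi : iIndepFun W μ) (hl : ∀ n, HasLaw (W n) (expMeasure lam) μ) (j : ℕ) (r : ℝ) :
    ∫⁻ ω, (if ∑ i ∈ Finset.range j, W i ω ≤ r ∧ r < ∑ i ∈ Finset.range (j + 1), W i ω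
      then 1 else 0) ∂μ = ENNReal.ofReal (poissonWeight lam j r) := by
  have hmeas : Measurable (Function.uncurry fun a b : ℝ =>
      if a ≤ r ∧ r < a + b then (1 : ℝ≥0∞) else 0) :=
    Measurable.ite ((measurableSet_le measurable_fst measurable_const).inter
      (measurableSet_lt measurable_const (measurable_fst.add measurable_snd)))
      measurable_const measurable_const
  have hind : IndepFun (fun ω => ∑ i ∈ Finset.range j, W i ω) (W j) μ := by
    have := hi.indepFun_finsetSum_of_notMem hm (s := Finset.range j) (i := j) (by simp)
    convert this using 1
    ext ω
    simp
  simp_rw [Finset.sum_range_succ _ j]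
  rw [lintegral_prodMk_of_indepFun (by fun_prop) (hm _) hind
    (F := fun a b => if a ≤ r ∧ r < a + b then 1 else 0) hmeas]
  have : ∀ ω, ∫⁻ ω', (if ∑ i ∈ Finset.range j, W i ω ≤ r ∧
        r < ∑ i ∈ Finset.range j, W i ω + W j ω' then (1 : ℝ≥0∞) else 0) ∂μ =
      ENNReal.ofReal (poissonWeight lam 0 (r - ∑ i ∈ Finset.range j, W i ω)) := fun ω => by
    rw [← expMeasure_tail hlam]
    exact (hl j).lintegral_comp (f := fun w => if ∑ i ∈ Finset.range j, W i ω ≤ r ∧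
        r < ∑ i ∈ Finset.range j, W i ω + w then 1 else 0)
      (hmeas.comp measurable_prodMk_left).aemeasurable
  simp_rw [this]
  cases j with
  | zero => simp
  | succ j =>
    rw [lintegral_sum_range_succ_exp hlam hm hi hl j
      (f := fun s => ENNReal.ofReal (poissonWeight lam 0 (r - s))) (by fun_prop),
      lintegral_poissonWeight_mul hlam]

end Sums

/-! ### Arrival times and the number of later arrivals -/

lemma IsRenewalSequence.ae_eq_sum {μ : Measure Ω} {T : ℕ → Ω → ℝ} {ν : Measure ℝ}
    (hT : IsRenewalSequence μ T ν) :
    ∀ᵐ ω ∂μ, ∀ n, T n ω = ∑ i ∈ Finset.range n, (T (i + 1) ω - T i ω) := by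
  filter_upwards [hT.zero] with ω h n
  rw [Finset.sum_range_sub (fun i => T i ω), h, sub_zero]

/-- The joint law of an arrival time and of the number of arrivals after it. -/
theorem IsRenewalSequence.lintegral_arrival {μ : Measure Ω} [IsProbabilityMeasure μ]
    {T : ℕ → Ω → ℝ} {lam : ℝ} (hlam : 0 < lam) (hT : IsRenewalSequence μ T (expMeasure lam))
    (n j : ℕ) (t : ℝ) {h : ℝ → ℝ≥0∞} (hh : Measurable h) :
    ∫⁻ ω, h (T (n + 1) ω) *
        (if T (n + 1 + j) ω ≤ t ∧ t < T (n + 1 + j + 1) ω then 1 else 0) ∂μ =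
      ∫⁻ s, h s * ENNReal.ofReal (poissonWeight lam j (t - s)) *
        ENNReal.ofReal (lam * poissonWeight lam n s) := by
  set W : ℕ → Ω → ℝ := fun n ω => T (n + 1) ω - T n ω with hW
  have hm : ∀ n, Measurable (W n) := fun n => (hT.measurable _).sub (hT.measurable _)
  let S : Ω → ℝ := fun ω => ∑ i ∈ Finset.range (n + 1), W i ω
  let V : Ω → ℝ × ℝ := fun ω => (∑ i ∈ Finset.range j, W (n + 1 + i) ω,
    ∑ i ∈ Finset.range (j + 1), W (n + 1 + i) ω)
  have hS : Measurable S := by fun_prop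
  have hV : Measurable V := by fun_prop
  have hind : IndepFun S V μ := by
    -- `S` uses the gaps `0, …, n` and `V` the gaps `n + 1, …, n + 1 + j`: disjoint blocks.
    have h0 := hT.indep.indepFun_finset (Finset.range (n + 1))
      (Finset.Ico (n + 1) (n + 1 + (j + 1))) (by
        rw [Finset.disjoint_left]; intro a ha hb
        simp only [Finset.mem_range, Finset.mem_Ico] at ha hb; omega) hm
    have h1 := h0.comp
      (φ := fun p : (Finset.range (n + 1)) → ℝ => ∑ i, p i)
      (ψ := fun p : (Finset.Ico (n + 1) (n + 1 + (j + 1))) → ℝ =>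
        ((∑ i : Fin j, p ⟨n + 1 + i, by simp only [Finset.mem_Ico]; omega⟩,
          ∑ i : Fin (j + 1), p ⟨n + 1 + i, by simp only [Finset.mem_Ico]; omega⟩) : ℝ × ℝ))
      (by fun_prop) (by fun_prop)
    convert h1 using 1
    · ext ω
      simp only [S, Function.comp]
      rw [Finset.sum_coe_sort (Finset.range (n + 1)) (fun i => W i ω)]
    · ext ω
      · simp only [V, Function.comp]
        rw [Finset.sum_range]
      · simp only [V, Function.comp]
        rw [Finset.sum_range]
  have hF : Measurable (Function.uncurry fun (s : ℝ) (v : ℝ × ℝ) =>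
      h s * (if s + v.1 ≤ t ∧ t < s + v.2 then 1 else 0)) := by
    refine (hh.comp measurable_fst).mul (Measurable.ite ?_ measurable_const measurable_const)
    exact (measurableSet_le (f := fun p : ℝ × ℝ × ℝ => p.1 + p.2.1) (by fun_prop)
      measurable_const).inter (measurableSet_lt (g := fun p : ℝ × ℝ × ℝ => p.1 + p.2.2)
        measurable_const (by fun_prop))
  have e1 : ∫⁻ ω, h (T (n + 1) ω) *
        (if T (n + 1 + j) ω ≤ t ∧ t < T (n + 1 + j + 1) ω then 1 else 0) ∂μ =
      ∫⁻ ω, h (S ω) * (if S ω + (V ω).1 ≤ t ∧ t < S ω + (V ω).2 then 1 else 0) ∂μ := by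
    refine lintegral_congr_ae ?_
    filter_upwards [hT.ae_eq_sum] with ω hω
    rw [hω (n + 1), hω (n + 1 + j), hω (n + 1 + j + 1), add_assoc (n + 1) j 1,
      Finset.sum_range_add _ (n + 1) j, Finset.sum_range_add _ (n + 1) (j + 1)]
  rw [e1, lintegral_prodMk_of_indepFun hS hV hind hF]
  have e2 : ∀ s : ℝ, ∫⁻ ω', h s * (if s + (V ω').1 ≤ t ∧ t < s + (V ω').2 then 1 else 0) ∂μ =
      h s * ENNReal.ofReal (poissonWeight lam j (t - s)) := by
    intro s
    -- After the arrival the process starts afresh: the shifted gaps are again i.i.d. exponential,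
    -- now with time `t - s` left.
    have hshift : iIndepFun (fun i => W (n + 1 + i)) μ :=
      hT.indep.precomp (g := fun i => n + 1 + i) (fun a b hab => by simpa using hab)
    rw [lintegral_const_mul]
    · rw [← lintegral_sum_range_le_lt hlam (fun i => hm (n + 1 + i)) hshift
        (fun i => hT.law (n + 1 + i))]
      congr 1
      refine lintegral_congr fun ω => ?_
      simp only [V, le_sub_iff_add_le', sub_lt_iff_lt_add']
    · exact Measurable.ite ((measurableSet_le (f := fun ω => s + (V ω).1) (by fun_prop)
        measurable_const).inter (measurableSet_lt (f := fun _ => t)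
          (g := fun ω => s + (V ω).2) (by fun_prop) (by fun_prop))) (by fun_prop) (by fun_prop)
  simp_rw [e2]
  exact lintegral_sum_range_succ_exp hlam hm hT.indep hT.law n
    (f := fun s => h s * ENNReal.ofReal (poissonWeight lam j (t - s))) (by fun_prop)

/-! ### Path probabilities of the chain -/

lemma measureReal_eq_sum_inter_preimage {β : Type*} [Fintype β] [MeasurableSpace β]
    [MeasurableSingletonClass β] {μ : Measure Ω} [IsFiniteMeasure μ] {Y : Ω → β}
    (hY : Measurable Y) (A : Set Ω) : μ.real A = ∑ w, μ.real (A ∩ {ω | Y ω = w}) := by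
  have h := sum_measureReal_preimage_singleton (μ := μ.restrict A) (f := Y) Finset.univ
    (fun y _ => hY (measurableSet_singleton y))
  simp only [Finset.coe_univ, Set.preimage_univ, measureReal_restrict_apply_univ] at h
  rw [← h]
  refine Finset.sum_congr rfl fun w _ => ?_
  rw [measureReal_restrict_apply (hY (measurableSet_singleton w)), Set.inter_comm]
  rfl

section Chain

variable {S : Type*} [Fintype S] [DecidableEq S] [MeasurableSpace S] [MeasurableSingletonClass S]
  {μ : Measure Ω} [IsFiniteMeasure μ] {X : ℕ → Ω → S} {P : Matrix S S ℝ}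

/-- The Markov property is given for full histories, so the induction on `j` keeps the whole history
general: it is prolonged by one state `w`, and summing over `w` gives the matrix product. -/
lemma IsStationaryErgodicChain.measureReal_path (hX : IsStationaryErgodicChain μ X P) (j n : ℕ)
    (x : ℕ → S) (y : S) :
    μ.real {ω | (∀ m ≤ n, X m ω = x m) ∧ X (n + j) ω = y} =
      μ.real {ω | ∀ m ≤ n, X m ω = x m} * (P ^ j) (x n) y := by
  induction j generalizing n x with
  | zero =>
    rw [pow_zero, Matrix.one_apply]
    split_ifs with h
    · rw [mul_one]
      congr 1
      ext ω
      simp only [add_zero, Set.mem_ofPred_eq, and_iff_left_iff_imp]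
      exact fun hω => (hω n le_rfl).trans h
    · rw [mul_zero]
      convert measureReal_empty
      ext ω
      simp only [add_zero, Set.mem_ofPred_eq, Set.mem_empty_iff_false, iff_false, not_and]
      exact fun hω hy => h ((hω n le_rfl).symm.trans hy)
  | succ j ih =>
    rw [measureReal_eq_sum_inter_preimage (hX.measurable (n + 1)), pow_succ', Matrix.mul_apply,
      Finset.mul_sum]
    refine Finset.sum_congr rfl fun w _ => ?_
    have key : ∀ ω, (∀ m ≤ n + 1, X m ω = Function.update x (n + 1) w m) ↔
        (∀ m ≤ n, X m ω = x m) ∧ X (n + 1) ω = w := by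
      intro ω
      constructor
      · intro h
        refine ⟨fun m hm => ?_, ?_⟩
        · rw [h m (by omega), Function.update_of_ne (by omega)]
        · rw [h (n + 1) le_rfl, Function.update_self]
      · rintro ⟨h1, h2⟩ m hm
        rcases Nat.lt_or_ge n m with h | h
        · obtain rfl : m = n + 1 := by omega
          rw [h2, Function.update_self]
        · rw [h1 m h, Function.update_of_ne (by omega)]
    have h := ih (n + 1) (Function.update x (n + 1) w)
    simp only [key, Function.update_self] at h
    rw [hX.markov n x w, mul_assoc] at h
    rw [← h]
    congr 1
    ext ω
    simp only [Set.mem_inter_iff, Set.mem_ofPred_eq, add_right_comm n 1 j, add_assoc]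
    tauto

lemma IsStationaryErgodicChain.measureReal_two (hX : IsStationaryErgodicChain μ X P) (n : ℕ)
    (x y : S) :
    μ.real {ω | X 0 ω = x ∧ X n ω = y} = μ.real {ω | X 0 ω = x} * (P ^ n) x y := by
  simpa using hX.measureReal_path n 0 (fun _ => x) y

/-- Both sides are split over all paths `p` of `X 0, …, X n`. Paths with ends `x` and `z` obey
`measureReal_path`; all others contribute zero. -/
lemma IsStationaryErgodicChain.measureReal_three (hX : IsStationaryErgodicChain μ X P) (n j : ℕ)
    (x z y : S) :
    μ.real {ω | X 0 ω = x ∧ X n ω = z ∧ X (n + j) ω = y} =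
      μ.real {ω | X 0 ω = x} * ((P ^ n) x z * (P ^ j) z y) := by
  rw [← mul_assoc, ← hX.measureReal_two]
  have hY : Measurable fun ω (m : Fin (n + 1)) => X m ω :=
    measurable_pi_lambda _ fun m => hX.measurable m
  rw [measureReal_eq_sum_inter_preimage hY,
    measureReal_eq_sum_inter_preimage hY {ω | X 0 ω = x ∧ X n ω = z}, Finset.sum_mul]
  refine Finset.sum_congr rfl fun p _ => ?_
  by_cases hp : p 0 = x ∧ p (Fin.last n) = z
  -- `Fin.ofNat` extends the finite path to all of `ℕ`; its values beyond `n` play no role.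
  · have key : ∀ ω, (∀ m ≤ n, X m ω = p (Fin.ofNat (n + 1) m)) ↔
        (fun m : Fin (n + 1) => X m ω) = p := by
      intro ω
      constructor
      · intro h
        funext m
        rw [h m (by omega)]
        simp
      · rintro rfl m hm
        simp [Nat.mod_eq_of_lt (Nat.lt_succ_of_le hm)]
    have h := hX.measureReal_path j n (fun m => p (Fin.ofNat (n + 1) m)) y
    have hn : Fin.ofNat (n + 1) n = Fin.last n := by ext; simp
    simp only [key, hn, hp.2] at h
    have e1 : {ω | X 0 ω = x ∧ X n ω = z ∧ X (n + j) ω = y} ∩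
        {ω | (fun m : Fin (n + 1) => X m ω) = p} =
        {ω | (fun m : Fin (n + 1) => X m ω) = p ∧ X (n + j) ω = y} := by
      ext ω
      simp only [Set.mem_inter_iff, Set.mem_ofPred_eq]
      constructor
      · tauto
      · rintro ⟨h1, h2⟩
        exact ⟨⟨by rw [← hp.1, ← h1]; rfl, by rw [← hp.2, ← h1]; rfl, h2⟩, h1⟩
    have e2 : {ω | X 0 ω = x ∧ X n ω = z} ∩
        {ω | (fun m : Fin (n + 1) => X m ω) = p} = {ω | (fun m : Fin (n + 1) => X m ω) = p} := by
      ext ω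
      simp only [Set.mem_inter_iff, Set.mem_ofPred_eq]
      constructor
      · tauto
      · intro h1
        exact ⟨⟨by rw [← hp.1, ← h1]; rfl, by rw [← hp.2, ← h1]; rfl⟩, h1⟩
    rw [e1, e2, h]
  · have h0 : ∀ ω, (fun m : Fin (n + 1) => X m ω) = p → ¬ (X 0 ω = x ∧ X n ω = z) := by
      rintro ω rfl h
      exact hp ⟨h.1, h.2⟩
    have e1 : {ω | X 0 ω = x ∧ X n ω = z ∧ X (n + j) ω = y} ∩
        {ω | (fun m : Fin (n + 1) => X m ω) = p} = ∅ := by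
      ext ω
      have := h0 ω
      simp only [Set.mem_inter_iff, Set.mem_ofPred_eq, Set.mem_empty_iff_false]
      tauto
    have e2 : {ω | X 0 ω = x ∧ X n ω = z} ∩
        {ω | (fun m : Fin (n + 1) => X m ω) = p} = ∅ := by
      ext ω
      have := h0 ω
      simp only [Set.mem_inter_iff, Set.mem_ofPred_eq, Set.mem_empty_iff_false]
      tauto
    rw [e1, e2]
    simp

/-- Some state carries mass; irreducibility leads from it to `x` in some number `n` of steps with
positive probability, and by stationarity `X n` has the law of `X 0`. -/
lemma IsStationaryErgodicChain.measureReal_init_pos [NeZero μ]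
    (hX : IsStationaryErgodicChain μ X P) (x : S) : 0 < μ.real {ω | X 0 ω = x} := by
  obtain ⟨x₀, hx₀⟩ : ∃ x₀, 0 < μ.real {ω | X 0 ω = x₀} := by
    by_contra! h
    have h1 := measureReal_eq_sum_inter_preimage (μ := μ) (hX.measurable 0) Set.univ
    rw [Finset.sum_eq_zero] at h1
    · exact (NeZero.ne μ) (Measure.measure_univ_eq_zero.1 ((measureReal_eq_zero_iff).1 h1))
    · intro w _
      rw [Set.univ_inter]
      exact le_antisymm (h w) measureReal_nonneg
  obtain ⟨n, -, hn⟩ := (Matrix.isIrreducible_iff_exists_pow_pos hX.irreducible.nonneg).1 hX.irreducible x₀ x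
  have h1 : 0 < μ.real {ω | X 0 ω = x₀ ∧ X n ω = x} := by
    rw [hX.measureReal_two]
    exact mul_pos hx₀ hn
  have h2 : μ.real {ω | X n ω = x} = μ.real {ω | X 0 ω = x} := by
    rw [measureReal_def, measureReal_def]
    congr 1
    exact (hX.stationary n).measure_mem_eq (measurableSet_singleton x)
  rw [← h2]
  exact h1.trans_le (measureReal_mono fun ω h => h.2)

end Chain

/-- The law of the mark `X n i` and of a later state of the chain, on the event `X 0 = x`. -/
lemma IsStationaryErgodicChain.lintegral_mark {k K : ℕ} {μ : Measure Ω} [IsFiniteMeasure μ]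
    {X : ℕ → Ω → State k K} {P : Matrix (State k K) (State k K) ℝ}
    (hX : IsStationaryErgodicChain μ X P) (i : Fin k) (n j : ℕ) (x y : State k K) :
    ∫⁻ ω, ENNReal.ofReal ((X n ω i : ℕ) : ℝ) * (if X 0 ω = x ∧ X (n + j) ω = y then 1 else 0) ∂μ =
      μ {ω | X 0 ω = x} * ENNReal.ofReal ((P ^ n * Delta k K i * P ^ j) x y) := by
  have hset : ∀ z, MeasurableSet {ω | X 0 ω = x ∧ X n ω = z ∧ X (n + j) ω = y} := fun z =>
    (hX.measurable 0 (measurableSet_singleton x)).inter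
      ((hX.measurable n (measurableSet_singleton z)).inter
        (hX.measurable (n + j) (measurableSet_singleton y)))
  have h1 : ∀ ω, ENNReal.ofReal ((X n ω i : ℕ) : ℝ) *
      (if X 0 ω = x ∧ X (n + j) ω = y then 1 else 0) =
      ∑ z : State k K, ENNReal.ofReal ((z i : ℕ) : ℝ) *
        {ω | X 0 ω = x ∧ X n ω = z ∧ X (n + j) ω = y}.indicator 1 ω := by
    intro ω
    rw [Finset.sum_eq_single (X n ω)]
    · simp [Set.indicator_apply]
    · intro z _ hz
      rw [Set.indicator_of_notMem (fun h => hz h.2.1.symm), mul_zero]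
    · simp
  simp_rw [h1]
  rw [lintegral_finsetSum _ fun z _ => (measurable_one.indicator (hset z)).const_mul _]
  have h2 : ∀ z, ∫⁻ ω, ENNReal.ofReal ((z i : ℕ) : ℝ) *
        {ω | X 0 ω = x ∧ X n ω = z ∧ X (n + j) ω = y}.indicator 1 ω ∂μ =
      μ {ω | X 0 ω = x} * ENNReal.ofReal ((P ^ n) x z * ((z i : ℕ) : ℝ) * (P ^ j) z y) := by
    intro z
    rw [lintegral_const_mul _ (measurable_one.indicator (hset z)), lintegral_indicator_one (hset z),
      ← ofReal_measureReal, hX.measureReal_three, ← ofReal_measureReal (s := {ω | X 0 ω = x}),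
      ← ENNReal.ofReal_mul (by positivity), ← ENNReal.ofReal_mul measureReal_nonneg]
    congr 1
    ring
  simp_rw [h2]
  rw [← Finset.mul_sum, ← ENNReal.ofReal_sum_of_nonneg]
  · congr 2
    rw [Matrix.mul_apply]
    refine Finset.sum_congr rfl fun z _ => ?_
    rw [Delta, Matrix.mul_diagonal]
  · intro z _
    have h3 := Matrix.pow_apply_nonneg hX.irreducible.nonneg n x z
    have h4 := Matrix.pow_apply_nonneg hX.irreducible.nonneg j z y
    positivity

/-! ### Discounted delays -/

/-- The discounted delay kernel `e^{-δ (l - v)} 1_{l > v}`. -/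
noncomputable def delayKernel (δ v l : ℝ) : ℝ :=
  Real.exp (-δ * (l - v)) * (if v < l then 1 else 0)

lemma delayKernel_nonneg (δ v l : ℝ) : 0 ≤ delayKernel δ v l := by
  unfold delayKernel
  split_ifs <;> positivity

lemma delayKernel_le_one {δ : ℝ} (hδ : 0 ≤ δ) (v l : ℝ) : delayKernel δ v l ≤ 1 := by
  unfold delayKernel
  split_ifs with h
  · rw [mul_one, Real.exp_le_one_iff]
    nlinarith
  · simp

@[fun_prop]
lemma measurable_delayKernel (δ : ℝ) : Measurable (Function.uncurry (delayKernel δ)) := by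
  refine Measurable.mul (by fun_prop) (Measurable.ite ?_ measurable_const measurable_const)
  exact measurableSet_lt measurable_fst measurable_snd

lemma discountedTail_eq (ρ : Measure ℝ) (δ v : ℝ) :
    discountedTail ρ δ v = ∫ l, delayKernel δ v l ∂ρ := by
  unfold discountedTail delayKernel
  congr! 4

lemma integrable_delayKernel (ρ : Measure ℝ) [IsProbabilityMeasure ρ] {δ : ℝ} (hδ : 0 ≤ δ) (v : ℝ) :
    Integrable (delayKernel δ v) ρ := by
  refine Integrable.of_bound (C := 1) (Measurable.aestronglyMeasurable ?_)
    (Filter.Eventually.of_forall fun l => ?_)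
  · exact (measurable_delayKernel δ).comp measurable_prodMk_left
  · rw [Real.norm_of_nonneg (delayKernel_nonneg _ _ _)]
    exact delayKernel_le_one hδ v l

lemma ofReal_discountedTail (ρ : Measure ℝ) [IsProbabilityMeasure ρ] {δ : ℝ} (hδ : 0 ≤ δ) (v : ℝ) :
    ENNReal.ofReal (discountedTail ρ δ v) = ∫⁻ l, ENNReal.ofReal (delayKernel δ v l) ∂ρ := by
  rw [discountedTail_eq, ofReal_integral_eq_lintegral_ofReal (integrable_delayKernel ρ hδ v)]
  exact Filter.Eventually.of_forall (delayKernel_nonneg δ v)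

lemma discountedTail_nonneg (ρ : Measure ℝ) (δ v : ℝ) : 0 ≤ discountedTail ρ δ v := by
  rw [discountedTail_eq]
  exact integral_nonneg (delayKernel_nonneg δ v)

lemma discountedTail_le_one (ρ : Measure ℝ) [IsProbabilityMeasure ρ] {δ : ℝ} (hδ : 0 ≤ δ) (v : ℝ) :
    discountedTail ρ δ v ≤ 1 := by
  rw [discountedTail_eq]
  simpa using integral_mono (integrable_delayKernel ρ hδ v) (integrable_const 1)
    (delayKernel_le_one hδ v)

lemma measurable_discountedTail (ρ : Measure ℝ) [IsProbabilityMeasure ρ] (δ : ℝ) :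
    Measurable (discountedTail ρ δ) := by
  rw [funext (discountedTail_eq ρ δ)]
  exact ((measurable_delayKernel δ).stronglyMeasurable.integral_prod_right).measurable

/-- The delay is independent of the entire arrival sequence, so it is averaged first with the times
frozen; this replaces the kernel by the discounted tail, a function of the arrival time to which
`lintegral_arrival` applies. -/
lemma lintegral_delay_arrival {k : ℕ} {μ : Measure Ω} [IsProbabilityMeasure μ] {lam δ : ℝ}
    (hlam : 0 < lam) (hδ : 0 ≤ δ) {T : ℕ → Ω → ℝ} {L : ℕ → Fin k → Ω → ℝ} {ρ : Fin k → Measure ℝ}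
    (hT : IsRenewalSequence μ T (expMeasure lam)) (hL : IsDelayFamily μ L ρ)
    (hTL : IndepFun (fun ω (n : ℕ) => T n ω) (fun ω (n : ℕ) (j : Fin k) => L n j ω) μ)
    (i : Fin k) (t : ℝ) (n j : ℕ) :
    ∫⁻ ω, ENNReal.ofReal (delayKernel δ (t - T (n + 1) ω) (L (n + 1) i ω)) *
        (if T (n + 1 + j) ω ≤ t ∧ t < T (n + 1 + j + 1) ω then 1 else 0) ∂μ =
      ∫⁻ s, ENNReal.ofReal (discountedTail (ρ i) δ (t - s)) *
        ENNReal.ofReal (poissonWeight lam j (t - s)) *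
        ENNReal.ofReal (lam * poissonWeight lam n s) := by
  have : IsProbabilityMeasure (ρ i) := (hL.law 0 i).isProbabilityMeasure_iff.1 inferInstance
  have hind : IndepFun (fun ω (n : ℕ) => T n ω) (L (n + 1) i) μ :=
    hTL.comp (ψ := fun l : ℕ → Fin k → ℝ => l (n + 1) i) measurable_id (by fun_prop)
  have hF : Measurable (Function.uncurry fun (τ : ℕ → ℝ) (l : ℝ) =>
      ENNReal.ofReal (delayKernel δ (t - τ (n + 1)) l) *
        (if τ (n + 1 + j) ≤ t ∧ t < τ (n + 1 + j + 1) then 1 else 0)) := by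
    refine Measurable.mul ?_ (Measurable.ite ?_ measurable_const measurable_const)
    · exact ((measurable_delayKernel δ).comp
        (g := delayKernel δ |> Function.uncurry)
        (f := fun p : (ℕ → ℝ) × ℝ => (t - p.1 (n + 1), p.2)) (by fun_prop)).ennreal_ofReal
    · exact (measurableSet_le (f := fun p : (ℕ → ℝ) × ℝ => p.1 (n + 1 + j)) (by fun_prop)
        measurable_const).inter (measurableSet_lt (f := fun _ => t)
          (g := fun p : (ℕ → ℝ) × ℝ => p.1 (n + 1 + j + 1)) (by fun_prop) (by fun_prop))
  rw [lintegral_prodMk_of_indepFun (measurable_pi_lambda _ hT.measurable) (hL.measurable _ _) hind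
    (F := fun (τ : ℕ → ℝ) (l : ℝ) => ENNReal.ofReal (delayKernel δ (t - τ (n + 1)) l) *
        (if τ (n + 1 + j) ≤ t ∧ t < τ (n + 1 + j + 1) then 1 else 0)) hF,
    ← hT.lintegral_arrival hlam n j t (h := fun s => ENNReal.ofReal (discountedTail (ρ i) δ (t - s)))
      ((measurable_discountedTail _ _).comp (measurable_const.sub measurable_id)).ennreal_ofReal]
  refine lintegral_congr fun ω => ?_
  have hm : Measurable fun l => ENNReal.ofReal (delayKernel δ (t - T (n + 1) ω) l) :=
    ((measurable_delayKernel δ).comp measurable_prodMk_left).ennreal_ofReal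
  refine (lintegral_mul_const _ (hm.comp (hL.measurable (n + 1) i))).trans ?_
  rw [ofReal_discountedTail _ hδ,
    ← (hL.law (n + 1) i).lintegral_comp hm.aemeasurable]
  rfl

/-! ### Decomposition of the moment by arrivals -/

/-- The contribution of the `n`-th arrival, when `j` more arrivals follow it up to time `t`. -/
noncomputable def arrivalTerm {k K : ℕ} (T : ℕ → Ω → ℝ) (X : ℕ → Ω → State k K)
    (L : ℕ → Fin k → Ω → ℝ) (δ : ℝ) (i : Fin k) (t : ℝ) (y : State k K) (n j : ℕ) (ω : Ω) : ℝ≥0∞ :=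
  ENNReal.ofReal ((X n ω i : ℕ) : ℝ) * (if X (n + j) ω = y then 1 else 0) *
    (ENNReal.ofReal (delayKernel δ (t - T n ω) (L n i ω)) *
      (if T (n + j) ω ≤ t ∧ t < T (n + j + 1) ω then 1 else 0))

lemma measurable_arrivalTerm {k K : ℕ} {T : ℕ → Ω → ℝ} {X : ℕ → Ω → State k K}
    {L : ℕ → Fin k → Ω → ℝ} (hT : ∀ n, Measurable (T n)) (hX : ∀ n, Measurable (X n))
    (hL : ∀ n j, Measurable (L n j)) (δ : ℝ) (i : Fin k) (t : ℝ) (y : State k K) (n j : ℕ) :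
    Measurable (arrivalTerm T X L δ i t y n j) := by
  refine Measurable.mul (Measurable.mul ?_ (Measurable.ite ?_ measurable_const measurable_const))
    (Measurable.mul ?_ (Measurable.ite ?_ measurable_const measurable_const))
  · exact (measurable_of_finite fun s : State k K => ENNReal.ofReal ((s i : ℕ) : ℝ)).comp (hX n)
  · exact hX (n + j) (measurableSet_singleton y)
  · exact ((measurable_delayKernel δ).comp
      ((measurable_const.sub (hT n)).prodMk (hL n i))).ennreal_ofReal
  · exact (measurableSet_le (hT _) measurable_const).inter (measurableSet_lt measurable_const (hT _))

/-- With the indicator of `X 0 = x` absorbed into the chain part, the term is a function of the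
chain times a function of times and delays, and the expectation factors. The prefactor `μ {X 0 = x}`
later cancels against conditioning. -/
lemma setLIntegral_arrivalTerm {k K : ℕ} {μ : Measure Ω} [IsProbabilityMeasure μ] {lam δ : ℝ}
    (hlam : 0 < lam) (hδ : 0 ≤ δ) {T : ℕ → Ω → ℝ} {X : ℕ → Ω → State k K}
    {L : ℕ → Fin k → Ω → ℝ} {P : Matrix (State k K) (State k K) ℝ} {ρ : Fin k → Measure ℝ}
    (hT : IsRenewalSequence μ T (expMeasure lam)) (hX : IsStationaryErgodicChain μ X P)
    (hL : IsDelayFamily μ L ρ)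
    (hXTL : IndepFun (fun ω (n : ℕ) => X n ω)
      (fun ω => ((fun n : ℕ => T n ω), (fun (n : ℕ) (j : Fin k) => L n j ω))) μ)
    (hTL : IndepFun (fun ω (n : ℕ) => T n ω) (fun ω (n : ℕ) (j : Fin k) => L n j ω) μ)
    (i : Fin k) (t : ℝ) (x y : State k K) (n j : ℕ) :
    ∫⁻ ω in {ω | X 0 ω = x}, arrivalTerm T X L δ i t y (n + 1) j ω ∂μ =
      μ {ω | X 0 ω = x} * ∫⁻ s, ENNReal.ofReal ((P ^ (n + 1) * Delta k K i * P ^ j) x y) *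
        (ENNReal.ofReal (discountedTail (ρ i) δ (t - s)) *
          ENNReal.ofReal (poissonWeight lam j (t - s)) *
          ENNReal.ofReal (lam * poissonWeight lam n s)) := by
  rw [lintegral_const_mul' _ _ ENNReal.ofReal_ne_top, ← mul_assoc, ← hX.lintegral_mark,
    ← lintegral_delay_arrival hlam hδ hT hL hTL, ← lintegral_indicator
      (show MeasurableSet {ω | X 0 ω = x} from hX.measurable 0 (measurableSet_singleton x))]
  have hA : Measurable fun ξ : ℕ → State k K => ENNReal.ofReal ((ξ (n + 1) i : ℕ) : ℝ) *
      (if ξ 0 = x ∧ ξ (n + 1 + j) = y then 1 else 0) := by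
    refine Measurable.mul ?_ (Measurable.ite ?_ measurable_const measurable_const)
    · exact (measurable_of_finite fun s : State k K => ENNReal.ofReal ((s i : ℕ) : ℝ)).comp
        (measurable_pi_apply (n + 1))
    · exact (measurable_pi_apply (X := fun _ : ℕ => State k K) 0 (measurableSet_singleton x)).inter
        (measurable_pi_apply (X := fun _ : ℕ => State k K) (n + 1 + j) (measurableSet_singleton y))
  have hB : Measurable fun p : (ℕ → ℝ) × (ℕ → Fin k → ℝ) =>
      ENNReal.ofReal (delayKernel δ (t - p.1 (n + 1)) (p.2 (n + 1) i)) *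
        (if p.1 (n + 1 + j) ≤ t ∧ t < p.1 (n + 1 + j + 1) then 1 else 0) := by
    refine Measurable.mul ?_ (Measurable.ite ?_ measurable_const measurable_const)
    · exact ((measurable_delayKernel δ).comp (g := delayKernel δ |> Function.uncurry)
        (f := fun p : (ℕ → ℝ) × (ℕ → Fin k → ℝ) => (t - p.1 (n + 1), p.2 (n + 1) i))
        (by fun_prop)).ennreal_ofReal
    · exact (measurableSet_le
        (f := fun p : (ℕ → ℝ) × (ℕ → Fin k → ℝ) => p.1 (n + 1 + j)) (by fun_prop)
        measurable_const).inter (measurableSet_lt (f := fun _ => t)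
          (g := fun p : (ℕ → ℝ) × (ℕ → Fin k → ℝ) => p.1 (n + 1 + j + 1))
          (by fun_prop) (by fun_prop))
  have hXm : Measurable fun ω (n : ℕ) => X n ω := measurable_pi_lambda _ hX.measurable
  have hTLm : Measurable fun ω => ((fun n : ℕ => T n ω), (fun (n : ℕ) (j : Fin k) => L n j ω)) :=
    (measurable_pi_lambda _ hT.measurable).prodMk
      (measurable_pi_lambda _ fun n => measurable_pi_lambda _ fun j => hL.measurable n j)
  have h := lintegral_mul_eq_lintegral_mul_lintegral_of_indepFun (hA.comp hXm) (hB.comp hTLm)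
    (hXTL.comp hA hB)
  refine Eq.trans (lintegral_congr fun ω => ?_) h
  simp only [arrivalTerm, Set.indicator_apply, Pi.mul_apply, Function.comp, Set.mem_ofPred_eq]
  by_cases hx : X 0 ω = x <;> simp [hx]

-- Monotonicity makes the counted set an initial segment. Only positive values are treated: `ncard`
-- is also `0` on an infinite set, whereas a positive value forces finiteness.
omit [MeasurableSpace Ω] in
lemma count_eq_succ_iff {T : ℕ → Ω → ℝ} {ω : Ω} (hmono : Monotone fun n => T n ω) (t : ℝ) (m : ℕ) :
    count T t ω = m + 1 ↔ T (m + 1) ω ≤ t ∧ t < T (m + 2) ω := by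
  have hIcc : ∀ m : ℕ, {n : ℕ | 1 ≤ n ∧ n ≤ m}.ncard = m := by
    intro m
    have : {n : ℕ | 1 ≤ n ∧ n ≤ m} = (Finset.Icc 1 m : Finset ℕ) := by ext; simp
    rw [this, Set.ncard_coe_finset, Nat.card_Icc, Nat.add_sub_cancel]
  have hfin : ∀ m : ℕ, {n : ℕ | 1 ≤ n ∧ n ≤ m}.Finite := fun m => Set.finite_Icc 1 m
  unfold count
  constructor
  · intro h
    have hf : {n : ℕ | 1 ≤ n ∧ T n ω ≤ t}.Finite := Set.finite_of_ncard_pos (by omega)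
    constructor
    · by_contra! h'
      have := Set.ncard_le_ncard (s := {n : ℕ | 1 ≤ n ∧ T n ω ≤ t}) (t := {n | 1 ≤ n ∧ n ≤ m})
        (fun n hn => ⟨hn.1, by
          by_contra! hlt
          exact absurd (hmono (show m + 1 ≤ n from hlt)) (by have := hn.2; simp only; linarith)⟩)
        (hfin m)
      rw [hIcc] at this
      omega
    · by_contra! h'
      have := Set.ncard_le_ncard (s := {n | 1 ≤ n ∧ n ≤ m + 2}) (t := {n : ℕ | 1 ≤ n ∧ T n ω ≤ t})
        (fun n hn => ⟨hn.1, (hmono hn.2).trans h'⟩) hf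
      rw [hIcc] at this
      omega
  · rintro ⟨h1, h2⟩
    rw [← hIcc (m + 1)]
    congr 1
    ext n
    simp only [Set.mem_ofPred_eq]
    refine and_congr_right fun _ => ⟨fun h => ?_, fun h => (hmono h).trans h1⟩
    by_contra! hlt
    exact absurd (hmono (show m + 2 ≤ n from hlt)) (by simp only; linarith)

lemma tsum_prod_eq_tsum_antidiagonal (f : ℕ × ℕ → ℝ≥0∞) :
    ∑' p, f p = ∑' m, ∑ p ∈ Finset.HasAntidiagonal.antidiagonal m, f p := by
  rw [← Finset.HasAntidiagonal.sigmaAntidiagonalEquivProd.tsum_eq, ENNReal.tsum_sigma']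
  refine tsum_congr fun m => ?_
  rw [tsum_fintype]
  exact Finset.sum_coe_sort (Finset.HasAntidiagonal.antidiagonal m) f

omit [MeasurableSpace Ω] in
lemma momentVar_nonneg {k K : ℕ} (T : ℕ → Ω → ℝ) (X : ℕ → Ω → State k K) (L : ℕ → Fin k → Ω → ℝ)
    (δ : ℝ) (i : Fin k) (t : ℝ) (y : State k K) (ω : Ω) : 0 ≤ momentVar T X L δ i t y ω := by
  unfold momentVar Ztilde Z
  refine mul_nonneg (mul_nonneg (Real.exp_nonneg _) (Finset.sum_nonneg fun n _ => ?_)) ?_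
  · refine mul_nonneg (by positivity) ?_
    split_ifs <;> simp
  · split_ifs <;> simp

omit [MeasurableSpace Ω] in
lemma ofReal_momentVar {k K : ℕ} {T : ℕ → Ω → ℝ} (X : ℕ → Ω → State k K) (L : ℕ → Fin k → Ω → ℝ)
    (δ : ℝ) (i : Fin k) (t : ℝ) (y : State k K) {ω : Ω} (hmono : Monotone fun n => T n ω) :
    ENNReal.ofReal (momentVar T X L δ i t y ω) =
      ∑' p : ℕ × ℕ, arrivalTerm T X L δ i t y (p.1 + 1) p.2 ω := by
  -- The term `(n, j)` lives on `N_t = n + 1 + j`, so only the antidiagonal of `N_t - 1` survives,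
  -- and none if the count is `0`, when the sum defining `Z` is empty too.
  have hoff : ∀ m, count T t ω ≠ m + 1 → ∀ p ∈ Finset.HasAntidiagonal.antidiagonal m,
      arrivalTerm T X L δ i t y (p.1 + 1) p.2 ω = 0 := by
    intro m hm p hp
    rw [Finset.HasAntidiagonal.mem_antidiagonal] at hp
    have : p.1 + 1 + p.2 = m + 1 := by omega
    rw [Ne, count_eq_succ_iff hmono] at hm
    unfold arrivalTerm
    rw [this, if_neg hm, mul_zero, mul_zero]
  rw [tsum_prod_eq_tsum_antidiagonal]
  rcases hN : count T t ω with _ | m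
  · have h0 : momentVar T X L δ i t y ω = 0 := by simp [momentVar, Ztilde, Z, hN]
    rw [h0, ENNReal.ofReal_zero, eq_comm, ENNReal.tsum_eq_zero]
    exact fun m => Finset.sum_eq_zero (hoff m (by omega))
  · rw [tsum_eq_single m fun m' hm' => Finset.sum_eq_zero (hoff m' (by omega))]
    have hE := (count_eq_succ_iff hmono t m).1 hN
    have h1 : ∀ p ∈ Finset.HasAntidiagonal.antidiagonal m, arrivalTerm T X L δ i t y (p.1 + 1) p.2 ω =
        ENNReal.ofReal (((X (p.1 + 1) ω i : ℕ) : ℝ) *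
          delayKernel δ (t - T (p.1 + 1) ω) (L (p.1 + 1) i ω) *
            (if X (m + 1) ω = y then 1 else 0)) := by
      intro p hp
      rw [Finset.HasAntidiagonal.mem_antidiagonal] at hp
      have : p.1 + 1 + p.2 = m + 1 := by omega
      unfold arrivalTerm
      rw [this, if_pos hE]
      split_ifs
      · rw [mul_one, mul_one, mul_one, ENNReal.ofReal_mul (by positivity)]
      · simp
    rw [Finset.sum_congr rfl h1, ← ENNReal.ofReal_sum_of_nonneg, ← Finset.sum_mul]
    · congr 1
      unfold momentVar Ztilde Z
      rw [hN]
      congr 1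
      rw [show Finset.Icc 1 (m + 1) = Finset.Ico (0 + 1) (m + 1 + 1) by ext; simp,
        ← Finset.sum_Ico_add', Finset.mul_sum, Finset.Nat.sum_antidiagonal_eq_sum_range_succ_mk,
        Finset.range_eq_Ico]
      refine Finset.sum_congr rfl fun n _ => ?_
      -- The factor `e^{δ t}` turns the discount at calendar time into the kernel at age `t - T (n +
      -- 1)`.
      have he : Real.exp (-δ * (L (n + 1) i ω - (t - T (n + 1) ω))) =
          Real.exp (δ * t) * Real.exp (-δ * (L (n + 1) i ω + T (n + 1) ω)) := by
        rw [← Real.exp_add]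
        ring_nf
      simp only [delayKernel, he, sub_lt_iff_lt_add]
      split_ifs <;> ring
    · intro p _
      refine mul_nonneg (mul_nonneg (by positivity) (delayKernel_nonneg _ _ _)) ?_
      split_ifs <;> simp

/-! ### Poisson series for exponentials -/

section BanachAlgebra

variable {R : Type*} [NormedRing R] [NormedAlgebra ℚ R] [NormedAlgebra ℝ R] [CompleteSpace R]

/-- The scalar part commutes with `p`, so `exp (λ s (p - 1)) = e^{-λ s} exp (λ s p)`, and the
exponential series has the Poisson weights as coefficients. -/
lemma hasSum_poissonWeight_smul_pow (p : R) (lam : ℝ) {s : ℝ} (hs : 0 ≤ s) :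
    HasSum (fun n => poissonWeight lam n s • p ^ n) (NormedSpace.exp ((lam * s) • (p - 1))) := by
  have h1 : NormedSpace.exp ((lam * s) • (p - 1)) =
      Real.exp (-(lam * s)) • NormedSpace.exp ((lam * s) • p) := by
    have h2 : (lam * s) • (p - 1) = algebraMap ℝ R (-(lam * s)) + (lam * s) • p := by
      rw [Algebra.algebraMap_eq_smul_one, smul_sub, neg_smul]
      abel
    rw [h2, NormedSpace.exp_add_of_commute (Algebra.commute_algebraMap_left _ _), Real.exp_eq_exp_ℝ,
      ← NormedSpace.algebraMap_exp_comm, ← Algebra.smul_def]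
  rw [h1]
  have h3 := (NormedSpace.exp_series_hasSum_exp' (𝕂 := ℝ) ((lam * s) • p)).const_smul
    (Real.exp (-(lam * s)))
  refine h3.congr_fun fun n => ?_
  rw [poissonWeight_of_nonneg _ _ hs, smul_pow, smul_smul, smul_smul]
  congr 1
  ring

lemma hasSum_poissonWeight_mul_pow [FiniteDimensional ℝ R] (p b : R) (lam : ℝ) {s v : ℝ}
    (hs : 0 ≤ s) (hv : 0 ≤ v) :
    HasSum (fun n : ℕ × ℕ => (poissonWeight lam n.1 s * poissonWeight lam n.2 v) •
        (p ^ n.1 * b * p ^ n.2))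
      (NormedSpace.exp ((lam * s) • (p - 1)) * b * NormedSpace.exp ((lam * v) • (p - 1))) := by
  have h1 := (hasSum_poissonWeight_smul_pow p lam hs).mul_right b
  have h2 := hasSum_poissonWeight_smul_pow p lam hv
  -- Finite dimension upgrades summability to absolute summability, as the product of series
  -- requires.
  have n1 := summable_norm_iff.2 h1.summable
  have n2 := summable_norm_iff.2 h2.summable
  have n3 := summable_mul_of_summable_norm n1 n2
  have h3 := h1.mul h2 n3
  have h4 : ∀ n : ℕ × ℕ, (poissonWeight lam n.1 s * poissonWeight lam n.2 v) •
      (p ^ n.1 * b * p ^ n.2) =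
      poissonWeight lam n.1 s • p ^ n.1 * b * poissonWeight lam n.2 v • p ^ n.2 := fun n => by
    simp only [smul_mul_assoc, mul_smul_comm, smul_smul, mul_comm]
  rw [funext h4]
  exact h3

lemma exp_smul_mul_exp_smul (a : R) (s v : ℝ) :
    NormedSpace.exp (s • a) * NormedSpace.exp (v • a) = NormedSpace.exp ((s + v) • a) := by
  rw [add_smul, NormedSpace.exp_add_of_commute (((Commute.refl a).smul_left s).smul_right v)]

end BanachAlgebra

section Matrix

open scoped Matrix.Norms.Operator

variable {S : Type*} [Fintype S] [DecidableEq S]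

lemma hasSum_poissonWeight_matrix (P B : Matrix S S ℝ) (lam : ℝ) {s v : ℝ} (hs : 0 ≤ s)
    (hv : 0 ≤ v) (x y : S) :
    HasSum (fun n : ℕ × ℕ => poissonWeight lam n.1 s * poissonWeight lam n.2 v *
        (P ^ n.1 * B * P ^ n.2) x y)
      ((NormedSpace.exp ((lam * s) • (P - 1)) * B * NormedSpace.exp ((lam * v) • (P - 1))) x y) :=
  Pi.hasSum.1 (Pi.hasSum.1 (hasSum_poissonWeight_mul_pow P B lam hs hv) x) y

lemma matrix_exp_smul_mul_exp_smul (A : Matrix S S ℝ) (s v : ℝ) :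
    NormedSpace.exp (s • A) * NormedSpace.exp (v • A) = NormedSpace.exp ((s + v) • A) :=
  exp_smul_mul_exp_smul A s v

lemma continuous_matrix_exp_smul (A : Matrix S S ℝ) {f : ℝ → ℝ} (hf : Continuous f) :
    Continuous fun v => NormedSpace.exp (f v • A) :=
  NormedSpace.exp_continuous.comp (hf.smul continuous_const)

end Matrix

/-! ### The integrand and its series -/

section Integrand

variable {k K : ℕ} {P : Matrix (State k K) (State k K) ℝ}

/-- Merging the outer exponential with the inner one leaves only nonnegative times `t - v` and `v`
when `0 ≤ v ≤ t`, where the Poisson expansion applies and gives nonnegative entries. -/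
lemma exp_mul_integrand (P : Matrix (State k K) (State k K) ℝ) (ρ : Measure ℝ) (lam δ : ℝ)
    (i : Fin k) (t v : ℝ) :
    NormedSpace.exp ((lam * t) • (P - 1)) * integrand P ρ lam δ i v =
      discountedTail ρ δ v • (NormedSpace.exp ((lam * (t - v)) • (P - 1)) * (P * Delta k K i) *
        NormedSpace.exp ((lam * v) • (P - 1))) := by
  unfold integrand
  rw [mul_smul_comm, ← mul_assoc, ← mul_assoc, matrix_exp_smul_mul_exp_smul, mul_sub,
    ← sub_eq_add_neg]

/-- The exponentials are continuous in `v`; the tail is measurable and lies in `[0, 1]`. -/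
lemma intervalIntegrable_integrand (P : Matrix (State k K) (State k K) ℝ) (ρ : Measure ℝ)
    [IsProbabilityMeasure ρ] (lam : ℝ) {δ : ℝ} (hδ : 0 ≤ δ) (i : Fin k) (a b : ℝ)
    (x y : State k K) :
    IntervalIntegrable (fun v => integrand P ρ lam δ i v x y) volume a b := by
  have hc : Continuous fun v => (NormedSpace.exp (-(lam * v) • (P - 1)) * (P * Delta k K i) *
      NormedSpace.exp ((lam * v) • (P - 1))) x y := by
    have h1 := continuous_matrix_exp_smul (P - 1) (f := fun v => -(lam * v)) (by fun_prop)
    have h2 := continuous_matrix_exp_smul (P - 1) (f := fun v => lam * v) (by fun_prop)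
    exact ((h1.matrix_mul continuous_const).matrix_mul h2).matrix_elem x y
  have hi := (hc.intervalIntegrable a b (μ := volume))
  rw [intervalIntegrable_iff] at hi ⊢
  refine (hi.bdd_mul (c := 1) (measurable_discountedTail ρ δ).aestronglyMeasurable
    (Filter.Eventually.of_forall fun v => ?_))
  rw [Real.norm_of_nonneg (discountedTail_nonneg _ _ _)]
  exact discountedTail_le_one ρ hδ v

/-- Nonnegativity and series expansion of the entries of `e^{lam s (P - 1)} P Δ_i e^{lam v (P - 1)}`. -/
lemma ofReal_exp_mul_mul_exp {lam : ℝ} (hlam : 0 < lam) (hP : ∀ x y, 0 ≤ P x y) (i : Fin k)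
    {s v : ℝ} (hs : 0 ≤ s) (hv : 0 ≤ v) (x y : State k K) :
    0 ≤ (NormedSpace.exp ((lam * s) • (P - 1)) * (P * Delta k K i) *
        NormedSpace.exp ((lam * v) • (P - 1))) x y ∧
    ENNReal.ofReal ((NormedSpace.exp ((lam * s) • (P - 1)) * (P * Delta k K i) *
        NormedSpace.exp ((lam * v) • (P - 1))) x y) =
      ∑' p : ℕ × ℕ, ENNReal.ofReal ((P ^ (p.1 + 1) * Delta k K i * P ^ p.2) x y) *
        (ENNReal.ofReal (poissonWeight lam p.2 v) * ENNReal.ofReal (poissonWeight lam p.1 s)) := by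
  have h := hasSum_poissonWeight_matrix P (P * Delta k K i) lam hs hv x y
  have hD : ∀ x y, 0 ≤ Delta k K i x y := by
    intro x y
    rw [Delta, Matrix.diagonal_apply]
    split_ifs <;> positivity
  have hmul : ∀ A B : Matrix (State k K) (State k K) ℝ, (∀ x y, 0 ≤ A x y) → (∀ x y, 0 ≤ B x y) →
      ∀ x y, 0 ≤ (A * B) x y := fun A B hA hB x y => by
    rw [Matrix.mul_apply]
    exact Finset.sum_nonneg fun z _ => mul_nonneg (hA _ _) (hB _ _)
  have hnn : ∀ p : ℕ × ℕ, 0 ≤ (P ^ p.1 * (P * Delta k K i) * P ^ p.2) x y := fun p =>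
    hmul _ _ (hmul _ _ (Matrix.pow_apply_nonneg hP _) (hmul _ _ hP hD))
      (Matrix.pow_apply_nonneg hP _) x y
  have hnn' : ∀ p : ℕ × ℕ, 0 ≤ poissonWeight lam p.1 s * poissonWeight lam p.2 v *
      (P ^ p.1 * (P * Delta k K i) * P ^ p.2) x y := fun p =>
    mul_nonneg (mul_nonneg (poissonWeight_nonneg hlam _ _) (poissonWeight_nonneg hlam _ _)) (hnn p)
  refine ⟨h.nonneg hnn', ?_⟩
  rw [← h.tsum_eq, ENNReal.ofReal_tsum_of_nonneg hnn' h.summable]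
  refine tsum_congr fun p => ?_
  -- The `P` in front of `Δ_i` raises the power to `p.1 + 1`: arrivals are numbered from one.
  rw [pow_succ, mul_assoc (P ^ p.1) P, mul_comm,
    ENNReal.ofReal_mul (hnn p), ENNReal.ofReal_mul (poissonWeight_nonneg hlam _ _),
    mul_comm (ENNReal.ofReal (poissonWeight lam p.1 s))]

lemma exp_mul_integrand_nonneg {lam : ℝ} (hlam : 0 < lam) (hP : ∀ x y, 0 ≤ P x y) (ρ : Measure ℝ)
    (δ : ℝ) (i : Fin k) {t v : ℝ} (hv : 0 ≤ v) (hvt : v ≤ t) (x y : State k K) :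
    0 ≤ (NormedSpace.exp ((lam * t) • (P - 1)) * integrand P ρ lam δ i v) x y := by
  rw [exp_mul_integrand, Matrix.smul_apply, smul_eq_mul]
  exact mul_nonneg (discountedTail_nonneg _ _ _)
    (ofReal_exp_mul_mul_exp hlam hP i (sub_nonneg.2 hvt) hv x y).1

/-- The substitution `v = t - s` passes from arrival time to age. Outside `[0, t]` one of the two
Poisson weights vanishes. -/
lemma lintegral_tsum_eq_setLIntegral_integrand {lam : ℝ} (hlam : 0 < lam) (hP : ∀ x y, 0 ≤ P x y)
    (ρ : Measure ℝ) (δ : ℝ) (i : Fin k) (t : ℝ) (x y : State k K) :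
    ∫⁻ s, ∑' p : ℕ × ℕ, ENNReal.ofReal ((P ^ (p.1 + 1) * Delta k K i * P ^ p.2) x y) *
        (ENNReal.ofReal (discountedTail ρ δ (t - s)) *
          ENNReal.ofReal (poissonWeight lam p.2 (t - s)) *
          ENNReal.ofReal (lam * poissonWeight lam p.1 s)) =
      ∫⁻ v in Set.Ioc 0 t, ENNReal.ofReal
        (lam * (NormedSpace.exp ((lam * t) • (P - 1)) * integrand P ρ lam δ i v) x y) := by
  rw [setLIntegral_congr Ioc_ae_eq_Icc, ← lintegral_indicator measurableSet_Icc,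
    ← lintegral_sub_left_eq_self _ t]
  refine lintegral_congr fun v => ?_
  rw [sub_sub_cancel]
  by_cases hv : v ∈ Set.Icc 0 t
  · have h0 := ofReal_exp_mul_mul_exp hlam hP i (sub_nonneg.2 hv.2) hv.1 x y
    rw [Set.indicator_of_mem hv, exp_mul_integrand, Matrix.smul_apply, smul_eq_mul,
      ENNReal.ofReal_mul hlam.le, ENNReal.ofReal_mul (discountedTail_nonneg _ _ _), h0.2,
      ← ENNReal.tsum_mul_left, ← ENNReal.tsum_mul_left]
    refine tsum_congr fun p => ?_
    rw [ENNReal.ofReal_mul hlam.le]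
    ring
  · rw [Set.indicator_of_notMem hv, ENNReal.tsum_eq_zero]
    intro p
    rcases lt_or_ge v 0 with h | h
    · simp [poissonWeight_of_neg lam p.2 h]
    · have : t < v := by by_contra! h'; exact hv ⟨h, h'⟩
      simp [poissonWeight_of_neg lam p.1 (show t - v < 0 by linarith)]

end Integrand

end IBNR

/-! ### Assembly -/

open IBNR in
theorem mainTheorem7 {Ω : Type*} [MeasurableSpace Ω] (μ : Measure Ω) [IsProbabilityMeasure μ]
    (k K : ℕ) (lam δ : ℝ) (hlam : 0 < lam) (hδ : 0 ≤ δ)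
    (T : ℕ → Ω → ℝ) (X : ℕ → Ω → IBNR.State k K) (L : ℕ → Fin k → Ω → ℝ)
    (P : Matrix (IBNR.State k K) (IBNR.State k K) ℝ) (ρ : Fin k → Measure ℝ)
    (hT : IBNR.IsRenewalSequence μ T (expMeasure lam))
    (hX : IBNR.IsStationaryErgodicChain μ X P)
    (hL : IBNR.IsDelayFamily μ L ρ)
    (hXTL : IndepFun (fun ω (n : ℕ) => X n ω)
      (fun ω => ((fun n : ℕ => T n ω), (fun (n : ℕ) (j : Fin k) => L n j ω))) μ)
    (hTL : IndepFun (fun ω (n : ℕ) => T n ω) (fun ω (n : ℕ) (j : Fin k) => L n j ω) μ)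
    (i : Fin k) (t : ℝ) (ht : 0 ≤ t) :
    (∀ x : IBNR.State k K, 0 < μ {ω | X 0 ω = x}) ∧
    (∀ x y : IBNR.State k K,
      Integrable (IBNR.momentVar T X L δ i t y) (cond μ {ω | X 0 ω = x})) ∧
    (∀ x y : IBNR.State k K,
      IntervalIntegrable (fun v => IBNR.integrand P (ρ i) lam δ i v x y) volume 0 t) ∧
    IBNR.M μ T X L δ i t =
      lam • (NormedSpace.exp ((lam * t) • (P - 1)) *
        IBNR.matrixIntegral (IBNR.integrand P (ρ i) lam δ i) 0 t) := by
  have : IsProbabilityMeasure (ρ i) := (hL.law 0 i).isProbabilityMeasure_iff.1 inferInstance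
  have hpos : ∀ x, 0 < μ {ω | X 0 ω = x} := fun x =>
    (ENNReal.toReal_pos_iff.1 (hX.measureReal_init_pos x)).1
  have hint := intervalIntegrable_integrand P (ρ i) lam hδ i 0 t
  have hP := hX.irreducible.nonneg
  -- With the outer exponential moved inside, the entries are nonnegative on `(0, t]`, so the real
  -- integral can be compared with a Lebesgue integral in `ℝ≥0∞`.
  set G : State k K → State k K → ℝ → ℝ := fun x y v =>
    lam * (NormedSpace.exp ((lam * t) • (P - 1)) * integrand P (ρ i) lam δ i v) x y with hG
  have hGsum : ∀ x y v, G x y v = lam * ∑ z, NormedSpace.exp ((lam * t) • (P - 1)) x z *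
      integrand P (ρ i) lam δ i v z y := fun x y v => by rw [hG]; simp only [Matrix.mul_apply]
  have hGint : ∀ x y, IntegrableOn (G x y) (Set.Ioc 0 t) := by
    intro x y
    rw [← intervalIntegrable_iff_integrableOn_Ioc_of_le ht, funext (hGsum x y)]
    have h := IntervalIntegrable.sum Finset.univ fun z _ =>
      (hint z y).const_mul (NormedSpace.exp ((lam * t) • (P - 1)) x z)
    simpa only [Finset.sum_apply] using h.const_mul lam
  have hG0 : ∀ x y, 0 ≤ᵐ[volume.restrict (Set.Ioc 0 t)] G x y := by
    intro x y
    filter_upwards [ae_restrict_mem measurableSet_Ioc] with v hv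
    exact mul_nonneg hlam.le (exp_mul_integrand_nonneg hlam hP _ _ _ hv.1.le hv.2 x y)
  have hterm : ∀ y n j, Measurable (arrivalTerm T X L δ i t y n j) :=
    measurable_arrivalTerm hT.measurable hX.measurable hL.measurable δ i t
  have hae : ∀ y, ∀ᵐ ω ∂μ, ENNReal.ofReal (momentVar T X L δ i t y ω) =
      ∑' p : ℕ × ℕ, arrivalTerm T X L δ i t y (p.1 + 1) p.2 ω := by
    intro y
    filter_upwards [hT.mono] with ω hω using ofReal_momentVar X L δ i t y hω
  have hac : ∀ x, cond μ {ω | X 0 ω = x} ≪ μ := fun x => cond_absolutelyContinuous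
  have hlint : ∀ x y, ∫⁻ ω, ENNReal.ofReal (momentVar T X L δ i t y ω)
      ∂(cond μ {ω | X 0 ω = x}) = ENNReal.ofReal (∫ v in Set.Ioc 0 t, G x y v) := by
    intro x y
    rw [lintegral_congr_ae ((hac x).ae_le (hae y)), lintegral_tsum fun p => (hterm y _ _).aemeasurable]
    simp_rw [ProbabilityTheory.cond, lintegral_smul_measure,
      setLIntegral_arrivalTerm hlam hδ hT hX hL hXTL hTL, smul_eq_mul, ← mul_assoc,
      ENNReal.inv_mul_cancel (hpos x).ne' (measure_ne_top _ _), one_mul, mul_assoc]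
    rw [ofReal_integral_eq_lintegral_ofReal (hGint x y) (hG0 x y), hG,
      ← lintegral_tsum_eq_setLIntegral_integrand hlam hP, lintegral_tsum]
    · simp_rw [mul_assoc]
    · intro p
      have := measurable_discountedTail (ρ i) δ
      exact Measurable.aemeasurable (by fun_prop)
  have hmeas : ∀ x y, AEStronglyMeasurable (momentVar T X L δ i t y) (cond μ {ω | X 0 ω = x}) := by
    intro x y
    -- Measurability is read off the series, which bypasses the random index `count`.
    refine AEMeasurable.aestronglyMeasurable ⟨fun ω =>
      (∑' p : ℕ × ℕ, arrivalTerm T X L δ i t y (p.1 + 1) p.2 ω).toReal, ?_, ?_⟩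
    · exact (Measurable.tsum fun p => hterm y _ _).ennreal_toReal
    · filter_upwards [(hac x).ae_le (hae y)] with ω hω
      rw [← hω, ENNReal.toReal_ofReal (momentVar_nonneg T X L δ i t y ω)]
  have hm0 : ∀ x y, 0 ≤ᵐ[cond μ {ω | X 0 ω = x}] momentVar T X L δ i t y := fun x y =>
    Filter.Eventually.of_forall (momentVar_nonneg T X L δ i t y)
  refine ⟨hpos, fun x y => ?_, hint, ?_⟩
  · rw [← lintegral_ofReal_ne_top_iff_integrable (hmeas x y) (hm0 x y), hlint]
    exact ENNReal.ofReal_ne_top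
  · ext x y
    rw [M, Matrix.of_apply, integral_eq_lintegral_of_nonneg_ae (hm0 x y) (hmeas x y), hlint,
      ENNReal.toReal_ofReal (integral_nonneg_of_ae (hG0 x y)),
      ← intervalIntegral.integral_of_le ht, funext (hGsum x y), intervalIntegral.integral_const_mul,
      intervalIntegral.integral_finsetSum fun z _ => (hint z y).const_mul _,
      Matrix.smul_apply, Matrix.mul_apply, smul_eq_mul]
    simp only [intervalIntegral.integral_const_mul, matrixIntegral, Matrix.of_apply]
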